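/- **Conventions.** Let $\Sigma$ be a $2$-polygraph: a set $\Sigma_0$ of $0$-cells, a set $\Sigma_1$ of generating $1$-cells (a directed graph on $\Sigma_0$), and a set $\Sigma_2$ of generating $2$-cells $\varphi : s \Rightarrow t$ between parallel $1$-cells of the free category $\Sigma_1^*$. Let $\Sigma_2^*$ and $\Sigma_2^\top$ be the free $2$-category and the free $(2,1)$-category on $\Sigma$, let $\star_1$ be the composition of $2$-cells along $1$-cells, and let $f^-$ be the $\star_1$-inverse of $f$. A *rewriting step* is a $2$-cell $u\varphi v$ of $\Sigma_2^*$ with $\varphi\in\Sigma_2$ and $u,v$ $1$-cells; a *rewriting sequence* is a finite, possibly empty, sequence of composable rewriting steps. A *globular extension* $\Gamma$ of $\Sigma_2^\top$ is a set of $3$-cells $A : f \Rrightarrow g$ between parallel $2$-cells of $\Sigma_2^\top$; $\equiv_\Gamma$ is the congruence it generates on the $2$-cells of $\Sigma_2^\top$. **Branchings.** A *local branching* is a pair $(f,g)$ of rewriting steps with the same source. It is *aspherical* if $f=g$, and *Peiffer* if it is of the form $(fv,ug)$ for rewriting steps $f:u\Rightarrow u'$ and $g:v\Rightarrow v'$ with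 $uv$ defined. It is *overlapping* if it is not aspherical and neither it nor $(g,f)$ is Peiffer, and *critical* if it is overlapping and minimal for the order $(f,g)\sqsubseteq(wfw',wgw')$ on local branchings. **Labellings.** Let $\psi$ be a map from the rewriting steps of $\Sigma$ to a set $W$ with a well-founded (partial) order $\prec$. A confluence diagram $(f\cdot f', g\cdot g')$ of a local branching $(f,g)$ consists of rewriting sequences $f',g'$ from the targets of $f$ and $g$ to a common target. It is *strictly decreasing* if every label in $f'$ is $\prec\psi(f)$ and every label in $g'$ is $\prec\psi(g)$. The pair $(\Sigma,\psi)$ is *strictly decreasing* if every local branching has a strictly decreasing confluence diagram. The labelling $\psi$ is *compatible with contexts* if, for every strictly decreasing confluence diagram $(f\cdot f',g\cdot g')$ of a local branching and all composable $1$-cells $u_1,u_2$, the diagram $(u_1fu_2\cdot u_1f'u_2,\ u_1gu_2\cdot u_1g'u_2)$ is strictly decreasing. The pair $(\Sigma,\psi)$ is *Peiffer decreasing with respect to* $\Gamma$ if every Peiffer branching $(fv,ug)$, with $f:u\Rightarrow u'$ and $g:v\Rightarrow v'$, has a strictly decreasing confluence diagram $(fv\cdot f',ug\cdot g')$ with $u'g\star_1(fv')^-\equiv_\Gamma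 f'\star_1(g')^-$. **Loops.** A *$2$-loop* is a $2$-cell of $\Sigma_2^*$ whose source and target are equal. Equivalence of $2$-loops is the equivalence relation generated by circular permutation of the steps in a decomposition $f=f_1\star_1\cdots\star_1 f_p$ into rewriting steps. A $2$-loop $f$ is *elementary* if it is not an identity and (i) whenever $f=g\star_1h\star_1k$ in $\Sigma_2^*$ with $h$ a $2$-loop, $h$ is an identity or $h=f$; and (ii) $f$ is not of the form $ugv$ with $g$ a $2$-loop and $u,v$ $1$-cells that are not both identities. **Completion.** A *strictly decreasing Squier completion* $\mathcal S^{sd}(\Sigma,\psi)$ extends $\Sigma$ by the globular extension of $\Sigma_2^\top$ that consists of * exactly one $3$-cell $f\star_1f'\Rrightarrow g\star_1g'$, with $(f\cdot f',g\cdot g')$ a strictly decreasing confluence diagram, for each critical branching $(f,g)$, where $(f,g)$ and $(g,f)$ count as the same branching; and * for exactly one representative $\alpha$ of each equivalence class of $2$-loops that contains an elementary $2$-loop, one $3$-cell $\alpha\Rrightarrow 1_{s_1(\alpha)}$, where $s_1(\alpha)$ is the source of $\alpha$. **Theorem.** Let $(\Sigma,\psi)$ be a strictly decreasing $2$-polygraph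 and let $\mathcal S^{sd}(\Sigma,\psi)$ be a strictly decreasing Squier completion of it. If $\psi$ is compatible with contexts and $(\Sigma,\psi)$ is Peiffer decreasing with respect to $\mathcal S^{sd}(\Sigma,\psi)$, then $\mathcal S^{sd}(\Sigma,\psi)$ is a coherent presentation of the category presented by $\Sigma$ (the quotient of $\Sigma_1^*$ by the congruence generated by $\Sigma_2$): for all parallel $2$-cells $f,g$ of $\Sigma_2^\top$ there is a $3$-cell from $f$ to $g$ in the free $(3,1)$-category generated by $\mathcal S^{sd}(\Sigma,\psi)$. -/

import Mathlib

open CategoryTheory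

universe u v w

/-- A `2`-polygraph: `0`-cells `Ob`, generating `1`-cells (the arrows of a quiver on `Ob`), and a
globular extension of the free category on that quiver. `Cell s t` is the set of generating
`2`-cells with `1`-source `s` and `1`-target `t`; since `s` and `t` are parallel paths, `(s, t)`
is a `1`-sphere. -/
structure TwoPolygraph where
  Ob : Type u
  [quiver : Quiver.{v} Ob]
  Cell : ∀ {x y : Ob}, Quiver.Path x y → Quiver.Path x y → Type w

attribute [instance] TwoPolygraph.quiver

namespace TwoPolygraph

variable (S : TwoPolygraph.{u, v, w})

/-! ### Cells of dimension one, rewriting steps and rewriting sequences -/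

/-- The `1`-cells from `x` to `y` of the free category on the generating `1`-cells. -/
def OneCell (x y : S.Ob) : Type (max u v) := Quiver.Path x y

variable {S}

/-- Composition of `1`-cells. -/
def OneCell.comp {x y z : S.Ob} (p : S.OneCell x y) (q : S.OneCell y z) : S.OneCell x z :=
  Quiver.Path.comp p q

/-- The number of generating `1`-cells in a `1`-cell; it is `0` exactly for the identities. -/
def OneCell.length {x y : S.Ob} (p : S.OneCell x y) : ℕ := Quiver.Path.length p

theorem OneCell.comp_assoc {x y z t : S.Ob} (p : S.OneCell x y) (q : S.OneCell y z)
    (r : S.OneCell z t) : (p.comp q).comp r = p.comp (q.comp r) :=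
  Quiver.Path.comp_assoc p q r

variable (S)

/-- A rewriting step `u φ v : p ⇒ q`, given by a generating `2`-cell `φ : s ⇒ t` and `1`-cells
`u = left`, `v = right` with `p = u s v` and `q = u t v`. -/
@[ext]
structure Step {x y : S.Ob} (p q : S.OneCell x y) where
  {a b : S.Ob}
  left : S.OneCell x a
  {s t : S.OneCell a b}
  cell : S.Cell s t
  right : S.OneCell b y
  source_eq : left.comp (s.comp right) = p
  target_eq : left.comp (t.comp right) = q

variable {S}

theorem Step.mk_eq {x y a b : S.Ob} {p q : S.OneCell x y} {l l' : S.OneCell x a}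
    {s t : S.OneCell a b} {c : S.Cell s t} {r r' : S.OneCell b y} (hl : l = l') (hr : r = r')
    (h₁ : l.comp (s.comp r) = p) (h₂ : l.comp (t.comp r) = q) (h₁' : l'.comp (s.comp r') = p)
    (h₂' : l'.comp (t.comp r') = q) :
    (⟨l, c, r, h₁, h₂⟩ : S.Step p q) = ⟨l', c, r', h₁', h₂'⟩ := by
  subst hl hr
  rfl

/-- The step `f`, with its source and target replaced by equal `1`-cells. -/
def Step.cast {x y : S.Ob} {p q p' q' : S.OneCell x y} (f : S.Step p q) (hp : p = p')
    (hq : q = q') : S.Step p' q' :=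
  ⟨f.left, f.cell, f.right, f.source_eq.trans hp, f.target_eq.trans hq⟩

/-- The step `u f`. -/
def Step.whiskerLeft {x y z : S.Ob} (u : S.OneCell x y) {p q : S.OneCell y z} (f : S.Step p q) :
    S.Step (u.comp p) (u.comp q) :=
  ⟨u.comp f.left, f.cell, f.right, by rw [OneCell.comp_assoc, f.source_eq],
    by rw [OneCell.comp_assoc, f.target_eq]⟩

/-- The step `f v`. -/
def Step.whiskerRight {x y z : S.Ob} {p q : S.OneCell x y} (f : S.Step p q) (v : S.OneCell y z) :
    S.Step (p.comp v) (q.comp v) :=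
  ⟨f.left, f.cell, f.right.comp v,
    by rw [← OneCell.comp_assoc, ← OneCell.comp_assoc, OneCell.comp_assoc f.left, f.source_eq],
    by rw [← OneCell.comp_assoc, ← OneCell.comp_assoc, OneCell.comp_assoc f.left, f.target_eq]⟩

/-- The step `u f v`. -/
def Step.whisker {x y a b : S.Ob} (u : S.OneCell a x) {p q : S.OneCell x y} (f : S.Step p q)
    (v : S.OneCell y b) : S.Step (u.comp (p.comp v)) (u.comp (q.comp v)) :=
  (f.whiskerRight v).whiskerLeft u

/-- The graph of rewriting steps between the `1`-cells from `x` to `y`. -/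
instance stepQuiver (x y : S.Ob) : Quiver (S.OneCell x y) where
  Hom p q := S.Step p q

variable (S)

/-- Finite rewriting sequences from `p` to `q`, possibly empty. -/
abbrev RewSeq {x y : S.Ob} (p q : S.OneCell x y) := Quiver.Path p q

variable {S}

/-- A rewriting step as a rewriting sequence of length one. -/
def Step.toSeq {x y : S.Ob} {p q : S.OneCell x y} (f : S.Step p q) : S.RewSeq p q :=
  Quiver.Path.nil.cons f

/-- The operation `f ↦ u f v` on `1`-cells and rewriting steps. -/
def whiskerPrefunctor {x y a b : S.Ob} (u : S.OneCell a x) (v : S.OneCell y b) :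
    S.OneCell x y ⥤q S.OneCell a b where
  obj p := u.comp (p.comp v)
  map f := Step.whisker u f v

/-- The rewriting sequence `u f v`, obtained from `f` step by step. -/
def RewSeq.whisker {x y a b : S.Ob} (u : S.OneCell a x) {p q : S.OneCell x y}
    (f : S.RewSeq p q) (v : S.OneCell y b) :
    S.RewSeq (u.comp (p.comp v)) (u.comp (q.comp v)) :=
  (whiskerPrefunctor u v).mapPath f

/-! ### The free `2`-category and the free `(2,1)`-category -/

/-- The Peiffer (exchange) relations `f v · u' g ∼ u g · f v'` between rewriting sequences, for
rewriting steps `f : u ⇒ u'` and `g : v ⇒ v'`. -/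
inductive PeifferRel {x z : S.Ob} : HomRel (Paths (S.OneCell x z))
  | exchange {y : S.Ob} {u u' : S.OneCell x y} {v v' : S.OneCell y z}
      (f : S.Step u u') (g : S.Step v v') {p q q' r : S.OneCell x z}
      (hp : u.comp v = p) (hq : u'.comp v = q) (hq' : u.comp v' = q') (hr : u'.comp v' = r) :
      PeifferRel (X := p) (Y := r)
        (((f.whiskerRight v).cast hp hq).toSeq.comp ((g.whiskerLeft u').cast hq hr).toSeq)
        (((g.whiskerLeft u).cast hp hq').toSeq.comp ((f.whiskerRight v').cast hq' hr).toSeq)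

variable (S)

/-- The hom-category from `x` to `y` of the free `2`-category on `S`: its objects are the
`1`-cells, its morphisms are the rewriting sequences modulo the congruence generated by the
Peiffer relations, and its composition is the `1`-composition. -/
abbrev HomCat (x y : S.Ob) := CategoryTheory.Quotient (PeifferRel (S := S) (x := x) (z := y))

/-- The `2`-cells `p ⇒ q` of the free `2`-category on `S`. -/
abbrev TwoCell {x y : S.Ob} (p q : S.OneCell x y) :=
  (⟨p⟩ : S.HomCat x y) ⟶ ⟨q⟩

/-- The hom-groupoid from `x` to `y` of the free `(2,1)`-category on `S`, obtained by formally
inverting all `2`-cells for the `1`-composition. -/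
abbrev HomGpd (x y : S.Ob) := FreeGroupoid (S.HomCat x y)

/-- The `2`-cells `p ⇒ q` of the free `(2,1)`-category on `S`. -/
abbrev InvTwoCell {x y : S.Ob} (p q : S.OneCell x y) :=
  (FreeGroupoid.mk (⟨p⟩ : S.HomCat x y)) ⟶ FreeGroupoid.mk (⟨q⟩ : S.HomCat x y)

variable {S}

/-- The `2`-cell of the free `2`-category given by a rewriting sequence. -/
def RewSeq.toTwoCell {x y : S.Ob} {p q : S.OneCell x y} (f : S.RewSeq p q) : S.TwoCell p q :=
  (CategoryTheory.Quotient.functor (PeifferRel (S := S) (x := x) (z := y))).map (X := p) (Y := q) f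

/-- The `2`-cell of the free `(2,1)`-category given by one of the free `2`-category. -/
def TwoCell.toInv {x y : S.Ob} {p q : S.OneCell x y} (f : S.TwoCell p q) : S.InvTwoCell p q :=
  FreeGroupoid.homMk f

/-- The `2`-cell of the free `(2,1)`-category given by a rewriting sequence. -/
noncomputable def RewSeq.toInv {x y : S.Ob} {p q : S.OneCell x y} (f : S.RewSeq p q) :
    S.InvTwoCell p q :=
  TwoCell.toInv f.toTwoCell

/-- The operation `f ↦ u f v` on rewriting sequences, as a functor. -/
def whiskerPaths {x y a b : S.Ob} (u : S.OneCell a x) (v : S.OneCell y b) :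
    Paths (S.OneCell x y) ⥤ Paths (S.OneCell a b) where
  obj p := (whiskerPrefunctor u v).obj p
  map f := (whiskerPrefunctor u v).mapPath f
  map_id _ := rfl
  map_comp f g := (whiskerPrefunctor u v).mapPath_comp f g

theorem whiskerPaths_rel {x y a b : S.Ob} (u : S.OneCell a x) (v : S.OneCell y b)
    (p q : Paths (S.OneCell x y)) (f g : p ⟶ q) (h : PeifferRel f g) :
    PeifferRel ((whiskerPaths u v).map f) ((whiskerPaths u v).map g) := by
  obtain @⟨y', p₁, p₂, q₁, q₂, f, g, _, _, _, _, rfl, rfl, rfl, rfl⟩ := h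
  have e (r : S.OneCell x y') (s : S.OneCell y' y) :
      (u.comp r).comp (s.comp v) = u.comp ((r.comp s).comp v) := by
    simp only [OneCell.comp_assoc]
  have h₁ {p q : S.OneCell x y'} (f : S.Step p q) (s : S.OneCell y' y) :
      Step.whisker u ((f.whiskerRight s).cast rfl rfl) v =
        ((f.whiskerLeft u).whiskerRight (s.comp v)).cast (e _ _) (e _ _) :=
    Step.mk_eq rfl (OneCell.comp_assoc _ _ _) _ _ _ _
  have h₂ {p q : S.OneCell y' y} (g : S.Step p q) (r : S.OneCell x y') :
      Step.whisker u ((g.whiskerLeft r).cast rfl rfl) v =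
        ((g.whiskerRight v).whiskerLeft (u.comp r)).cast (e _ _) (e _ _) :=
    Step.mk_eq (OneCell.comp_assoc _ _ _).symm rfl _ _ _ _
  have key := PeifferRel.exchange (f.whiskerLeft u) (g.whiskerRight v) (e _ _) (e _ _) (e _ _)
    (e _ _)
  rw [← h₁, ← h₁, ← h₂, ← h₂] at key
  exact key

/-- The operation `f ↦ u f v` on the free `2`-category. -/
def whiskerFunctor {x y a b : S.Ob} (u : S.OneCell a x) (v : S.OneCell y b) :
    S.HomCat x y ⥤ S.HomCat a b :=
  CategoryTheory.Quotient.lift _ (whiskerPaths u v ⋙ CategoryTheory.Quotient.functor _)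
    (fun p q f g h => CategoryTheory.Quotient.sound _ (whiskerPaths_rel u v p q f g h))

/-- The `2`-cell `u f v` of the free `2`-category. -/
def TwoCell.whisker {x y a b : S.Ob} (u : S.OneCell a x) {p q : S.OneCell x y}
    (f : S.TwoCell p q) (v : S.OneCell y b) :
    S.TwoCell (u.comp (p.comp v)) (u.comp (q.comp v)) :=
  (whiskerFunctor u v).map f

/-- The `2`-cell `u f v` of the free `(2,1)`-category. -/
noncomputable def InvTwoCell.whisker {x y a b : S.Ob} (u : S.OneCell a x) {p q : S.OneCell x y}
    (f : S.InvTwoCell p q) (v : S.OneCell y b) :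
    S.InvTwoCell (u.comp (p.comp v)) (u.comp (q.comp v)) :=
  (FreeGroupoid.map (whiskerFunctor u v)).map f

/-! ### Globular extensions and coherent presentations -/

variable (S)

/-- A globular extension of the free `(2,1)`-category on `S`: a set of `3`-cells with a `2`-source
and a `2`-target that are parallel `2`-cells. The pair `(S, Γ)` is a `(3,1)`-polygraph. -/
structure GlobularExtension where
  Cell : Type*
  {x y : Cell → S.Ob}
  {p q : ∀ A : Cell, S.OneCell (x A) (y A)}
  source : ∀ A : Cell, S.InvTwoCell (p A) (q A)
  target : ∀ A : Cell, S.InvTwoCell (p A) (q A)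

variable {S}

namespace GlobularExtension

/-- The union of two families of `3`-cells. -/
def union (Γ Δ : S.GlobularExtension) : S.GlobularExtension where
  Cell := Γ.Cell ⊕ Δ.Cell
  x := Sum.elim Γ.x Δ.x
  y := Sum.elim Γ.y Δ.y
  p A := match A with
    | .inl A => Γ.p A
    | .inr A => Δ.p A
  q A := match A with
    | .inl A => Γ.q A
    | .inr A => Δ.q A
  source A := match A with
    | .inl A => Γ.source A
    | .inr A => Δ.source A
  target A := match A with
    | .inl A => Γ.target A
    | .inr A => Δ.target A

/-- `Γ.Congr f g` is the relation `f ≡_Γ g`: the congruence on the `2`-cells of the free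
`(2,1)`-category generated by the pairs `(source A, target A)`, for `A` in `Γ`. -/
inductive Congr (Γ : S.GlobularExtension) :
    ∀ {x y : S.Ob} {p q : S.OneCell x y}, S.InvTwoCell p q → S.InvTwoCell p q → Prop
  | of (A : Γ.Cell) : Congr Γ (Γ.source A) (Γ.target A)
  | refl {x y : S.Ob} {p q : S.OneCell x y} (f : S.InvTwoCell p q) : Congr Γ f f
  | symm {x y : S.Ob} {p q : S.OneCell x y} {f g : S.InvTwoCell p q} :
      Congr Γ f g → Congr Γ g f
  | trans {x y : S.Ob} {p q : S.OneCell x y} {f g h : S.InvTwoCell p q} :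
      Congr Γ f g → Congr Γ g h → Congr Γ f h
  | comp {x y : S.Ob} {p q r : S.OneCell x y} {f f' : S.InvTwoCell p q} {g g' : S.InvTwoCell q r} :
      Congr Γ f f' → Congr Γ g g' → Congr Γ (f ≫ g) (f' ≫ g')
  | whisker {x y a b : S.Ob} (u : S.OneCell a x) (v : S.OneCell y b) {p q : S.OneCell x y}
      {f g : S.InvTwoCell p q} :
      Congr Γ f g → Congr Γ (InvTwoCell.whisker u f v) (InvTwoCell.whisker u g v)

/-- Expressions for the `3`-cells from `f` to `g` in the free `(3,1)`-category generated by
`(S, Γ)`: they are built from the generating `3`-cells by identities, inverses and composition for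
the `2`-composition, by `1`-composition, and by composition with `1`-cells on both sides.
The `3`-cells of the free `(3,1)`-category are these expressions modulo the axioms of
`(3,1)`-categories, so a `3`-cell from `f` to `g` exists if and only if such an expression does. -/
inductive ThreeCell (Γ : S.GlobularExtension) :
    ∀ {x y : S.Ob} {p q : S.OneCell x y}, S.InvTwoCell p q → S.InvTwoCell p q → Type _
  | of (A : Γ.Cell) : ThreeCell Γ (Γ.source A) (Γ.target A)
  | id {x y : S.Ob} {p q : S.OneCell x y} (f : S.InvTwoCell p q) : ThreeCell Γ f f
  | inv {x y : S.Ob} {p q : S.OneCell x y} {f g : S.InvTwoCell p q} :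
      ThreeCell Γ f g → ThreeCell Γ g f
  | comp₂ {x y : S.Ob} {p q : S.OneCell x y} {f g h : S.InvTwoCell p q} :
      ThreeCell Γ f g → ThreeCell Γ g h → ThreeCell Γ f h
  | comp₁ {x y : S.Ob} {p q r : S.OneCell x y} {f f' : S.InvTwoCell p q}
      {g g' : S.InvTwoCell q r} :
      ThreeCell Γ f f' → ThreeCell Γ g g' → ThreeCell Γ (f ≫ g) (f' ≫ g')
  | whisker {x y a b : S.Ob} (u : S.OneCell a x) (v : S.OneCell y b) {p q : S.OneCell x y}
      {f g : S.InvTwoCell p q} :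
      ThreeCell Γ f g → ThreeCell Γ (InvTwoCell.whisker u f v) (InvTwoCell.whisker u g v)

/-- `Γ` is a homotopy basis: every `2`-sphere `(f, g)` of the free `(2,1)`-category is filled by a
`3`-cell of the free `(3,1)`-category. -/
def IsHomotopyBasis (Γ : S.GlobularExtension) : Prop :=
  ∀ {x y : S.Ob} {p q : S.OneCell x y} (f g : S.InvTwoCell p q), Nonempty (Γ.ThreeCell f g)

end GlobularExtension

variable (S)

/-- The relation on the free category on the generating `1`-cells given by the generating
`2`-cells. -/
def cellRel : HomRel (Paths S.Ob) := fun _ _ p q => Nonempty (S.Cell p q)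

/-- The category presented by `S`: the quotient of the free category on the generating `1`-cells
by the congruence generated by the generating `2`-cells. -/
abbrev PresentedCategory := CategoryTheory.Quotient S.cellRel

/-- `S` is a presentation of the category `C`: the category presented by `S` is isomorphic
to `C`. -/
def IsPresentationOf (C : Type*) [Category* C] : Prop :=
  ∃ (F : S.PresentedCategory ⥤ C) (G : C ⥤ S.PresentedCategory), F ⋙ G = 𝟭 _ ∧ G ⋙ F = 𝟭 _

variable {S}

/-- `(S, Γ)` is a coherent presentation of the category `C`. -/
def GlobularExtension.IsCoherentPresentationOf (Γ : S.GlobularExtension) (C : Type*)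
    [Category* C] : Prop :=
  S.IsPresentationOf C ∧ Γ.IsHomotopyBasis

/-! ### Loops -/

variable (S)

/-- A `2`-loop of the free `2`-category. -/
structure Loop where
  {x y : S.Ob}
  {base : S.OneCell x y}
  cell : S.TwoCell base base

variable {S}

namespace Loop

/-- `f` and `g` are related by a circular permutation of the steps of a decomposition of `f` into
rewriting steps. -/
inductive Rotation : S.Loop → S.Loop → Prop
  | mk {x y : S.Ob} {p q : S.OneCell x y} (h : S.RewSeq p q) (k : S.RewSeq q p) :
      Rotation ⟨RewSeq.toTwoCell (h.comp k)⟩ ⟨RewSeq.toTwoCell (k.comp h)⟩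

variable (S) in
/-- Equivalence classes of `2`-loops, for the equivalence relation generated by circular
permutations. -/
def Class := Quot (Rotation (S := S))

/-- The equivalence class of a `2`-loop. -/
def toClass (f : S.Loop) : Class S := Quot.mk _ f

/-- The `2`-loop is an identity. -/
def IsIdentity (f : S.Loop) : Prop := f.cell = 𝟙 _

/-- The `2`-loop `u g v`. -/
def whisker {a b : S.Ob} (g : S.Loop) (u : S.OneCell a g.x) (v : S.OneCell g.y b) : S.Loop :=
  ⟨TwoCell.whisker u g.cell v⟩

/-- Minimality with respect to `1`-composition. -/
def IsMinimalForComp (f : S.Loop) : Prop :=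
  ∀ (q : S.OneCell f.x f.y) (g : S.TwoCell f.base q) (h : S.TwoCell q q) (k : S.TwoCell q f.base),
    f.cell = g ≫ h ≫ k → IsIdentity ⟨h⟩ ∨ (⟨h⟩ : S.Loop) = f

/-- Minimality by context: `f` is not of the form `u g v` for a `2`-loop `g` and `1`-cells `u`, `v`
that are not both identities. -/
def IsMinimalByContext (f : S.Loop) : Prop :=
  ¬ ∃ (a b : S.Ob) (g : S.Loop) (u : S.OneCell a g.x) (v : S.OneCell g.y b),
    (u.length ≠ 0 ∨ v.length ≠ 0) ∧ f = g.whisker u v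

/-- Elementary `2`-loops: the nonidentity ones that are minimal in both senses. -/
def IsElementary (f : S.Loop) : Prop :=
  ¬ f.IsIdentity ∧ f.IsMinimalForComp ∧ f.IsMinimalByContext

end Loop

variable (S)

/-- The equivalence classes of elementary `2`-loops. -/
def ElementaryClass := {c : Loop.Class S // ∃ f : S.Loop, f.IsElementary ∧ f.toClass = c}

/-- A loop extension of `S`: the choice of exactly one representative of each equivalence class of
elementary `2`-loops. -/
structure LoopExtension where
  rep : S.ElementaryClass → S.Loop
  toClass_rep : ∀ c, (rep c).toClass = c.1

variable {S}

/-- The `3`-cells of a loop extension: one `3`-cell from `α` to the identity for each chosen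
representative `α`. -/
noncomputable def LoopExtension.toGlobularExtension (L : S.LoopExtension) :
    S.GlobularExtension where
  Cell := S.ElementaryClass
  source c := TwoCell.toInv (L.rep c).cell
  target c := 𝟙 (FreeGroupoid.mk (⟨(L.rep c).base⟩ : S.HomCat _ _))

/-! ### Local branchings -/

variable (S)

/-- A local branching: a pair of rewriting steps with the same source. -/
structure LocalBranching where
  {x y : S.Ob}
  {src tgt₁ tgt₂ : S.OneCell x y}
  fst : S.Step src tgt₁
  snd : S.Step src tgt₂

variable {S}

namespace LocalBranching

/-- The branching `(g, f)`, for a branching `(f, g)`. -/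
def swap (b : S.LocalBranching) : S.LocalBranching := ⟨b.snd, b.fst⟩

/-- The branching `(u f v, u g v)`, for a branching `(f, g)`. -/
def whisker (b : S.LocalBranching) {x' y' : S.Ob} (u : S.OneCell x' b.x) (v : S.OneCell b.y y') :
    S.LocalBranching :=
  ⟨Step.whisker u b.fst v, Step.whisker u b.snd v⟩

/-- The Peiffer branching `(f v, u g)` of the steps `f : u ⇒ u'` and `g : v ⇒ v'`. -/
def peiffer {x y z : S.Ob} {u u' : S.OneCell x y} {v v' : S.OneCell y z} (f : S.Step u u')
    (g : S.Step v v') : S.LocalBranching :=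
  ⟨f.whiskerRight v, g.whiskerLeft u⟩

/-- Aspherical branchings `(f, f)`. -/
def IsAspherical (b : S.LocalBranching) : Prop :=
  ∃ (x y : S.Ob) (p q : S.OneCell x y) (f : S.Step p q), b = ⟨f, f⟩

/-- Branchings of the form `(f v, u g)`. -/
def IsPeiffer (b : S.LocalBranching) : Prop :=
  ∃ (x y z : S.Ob) (u u' : S.OneCell x y) (v v' : S.OneCell y z) (f : S.Step u u')
    (g : S.Step v v'), b = peiffer f g

/-- Overlapping branchings: neither aspherical nor, in either order, Peiffer. -/
def IsOverlapping (b : S.LocalBranching) : Prop :=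
  ¬ b.IsAspherical ∧ ¬ b.IsPeiffer ∧ ¬ b.swap.IsPeiffer

/-- The order `(f, g) ⊑ (u f v, u g v)` on local branchings. -/
def ContextLE (b c : S.LocalBranching) : Prop :=
  ∃ (x' y' : S.Ob) (u : S.OneCell x' b.x) (v : S.OneCell b.y y'), c = b.whisker u v

/-- Critical branchings: the overlapping branchings that are minimal for `⊑`. -/
def IsCritical (b : S.LocalBranching) : Prop :=
  b.IsOverlapping ∧ ∀ c : S.LocalBranching, c.ContextLE b → c = b

end LocalBranching

/-- A confluence of the local branching `(f, g)`: rewriting sequences `f'` and `g'` from the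
targets of `f` and `g` to a common target. It gives the confluence diagram `(f · f', g · g')`. -/
structure Confluence (b : S.LocalBranching) where
  {tgt : S.OneCell b.x b.y}
  fst : S.RewSeq b.tgt₁ tgt
  snd : S.RewSeq b.tgt₂ tgt

namespace Confluence

/-- The confluence diagram `(u f v · u f' v, u g v · u g' v)`. -/
def whisker {b : S.LocalBranching} (D : Confluence b) {x' y' : S.Ob} (u : S.OneCell x' b.x)
    (v : S.OneCell b.y y') : Confluence (b.whisker u v) :=
  ⟨RewSeq.whisker u D.fst v, RewSeq.whisker u D.snd v⟩

/-- The rewriting sequence `f · f'` of a confluence diagram `(f · f', g · g')`. -/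
def side₁ {b : S.LocalBranching} (D : Confluence b) : S.RewSeq b.src D.tgt :=
  b.fst.toSeq.comp D.fst

/-- The rewriting sequence `g · g'` of a confluence diagram `(f · f', g · g')`. -/
def side₂ {b : S.LocalBranching} (D : Confluence b) : S.RewSeq b.src D.tgt :=
  b.snd.toSeq.comp D.snd

end Confluence

/-! ### Labellings and decreasingness -/

variable (S)

/-- A labelling of the rewriting steps of `S` in `W`. It is a well-founded labelling when `W`
carries a well-founded order. -/
def Labelling (W : Type*) := ∀ {x y : S.Ob} {p q : S.OneCell x y}, S.Step p q → W

variable {S}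

namespace Labelling

variable {W : Type*}

/-- The set of labels of the steps of a rewriting sequence. -/
def labels (ψ : S.Labelling W) {x y : S.Ob} {p : S.OneCell x y} :
    ∀ {q : S.OneCell x y}, S.RewSeq p q → Set W
  | _, .nil => ∅
  | _, .cons f e => insert (ψ e) (labels ψ f)

variable [PartialOrder W]

/-- The confluence diagram `(f · f', g · g')` is strictly decreasing: the labels of `f'` are less
than the label of `f`, and the labels of `g'` are less than the label of `g`. -/
def IsStrictlyDecreasingDiagram (ψ : S.Labelling W) {b : S.LocalBranching} (D : Confluence b) :
    Prop :=
  (∀ k ∈ ψ.labels D.fst, k < ψ b.fst) ∧ (∀ k ∈ ψ.labels D.snd, k < ψ b.snd)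

/-- `(S, ψ)` is strictly decreasing: every local branching has a strictly decreasing confluence
diagram. -/
def IsStrictlyDecreasing (ψ : S.Labelling W) : Prop :=
  ∀ b : S.LocalBranching, ∃ D : Confluence b, ψ.IsStrictlyDecreasingDiagram D

/-- `ψ` is compatible with contexts: if `(f · f', g · g')` is a strictly decreasing confluence
diagram of a local branching, then so is `(u f v · u f' v, u g v · u g' v)`. -/
def IsCompatibleWithContexts (ψ : S.Labelling W) : Prop :=
  ∀ (b : S.LocalBranching) (D : Confluence b), ψ.IsStrictlyDecreasingDiagram D →
    ∀ (x' y' : S.Ob) (u : S.OneCell x' b.x) (v : S.OneCell b.y y'),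
      ψ.IsStrictlyDecreasingDiagram (D.whisker u v)

/-- `(S, ψ)` is Peiffer decreasing with respect to `Γ`: every Peiffer branching `(f v, u g)` has a
strictly decreasing confluence diagram `(f v · f', u g · g')` with
`u' g ⋆₁ (f v')⁻ ≡_Γ f' ⋆₁ (g')⁻`. -/
def IsPeifferDecreasing (ψ : S.Labelling W) (Γ : S.GlobularExtension) : Prop :=
  ∀ {x y z : S.Ob} {u u' : S.OneCell x y} {v v' : S.OneCell y z} (f : S.Step u u')
    (g : S.Step v v'),
    ∃ D : Confluence (LocalBranching.peiffer f g), ψ.IsStrictlyDecreasingDiagram D ∧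
      Γ.Congr
        ((g.whiskerLeft u').toSeq.toInv ≫ Groupoid.inv (f.whiskerRight v').toSeq.toInv)
        (RewSeq.toInv D.fst ≫ Groupoid.inv (RewSeq.toInv D.snd))

/-- A family of generating strictly decreasing confluences: exactly one strictly decreasing
confluence diagram for each critical branching, the branchings `(f, g)` and `(g, f)` being
regarded as the same one. The set `carrier` chooses one of the two. -/
structure GeneratingConfluences (ψ : S.Labelling W) where
  carrier : Set S.LocalBranching
  critical : ∀ b ∈ carrier, b.IsCritical
  exactly_one : ∀ b : S.LocalBranching, b.IsCritical → Xor (b ∈ carrier) (b.swap ∈ carrier)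
  diagram : ∀ b : carrier, Confluence b.1
  decreasing : ∀ b : carrier, ψ.IsStrictlyDecreasingDiagram (diagram b)

/-- The `3`-cells `f ⋆₁ f' ⇛ g ⋆₁ g'` of a family of generating confluences. -/
noncomputable def GeneratingConfluences.toGlobularExtension {ψ : S.Labelling W}
    (O : ψ.GeneratingConfluences) : S.GlobularExtension where
  Cell := O.carrier
  source b := (O.diagram b).side₁.toInv
  target b := (O.diagram b).side₂.toInv

/-- The strictly decreasing Squier completion given by a family of generating strictly decreasing
confluences and a loop extension. -/
noncomputable def squierCompletion {ψ : S.Labelling W} (O : ψ.GeneratingConfluences)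
    (L : S.LoopExtension) : S.GlobularExtension :=
  O.toGlobularExtension.union L.toGlobularExtension

end Labelling

end TwoPolygraph

/-! The argument is a coherent form of Newman's lemma in which termination is replaced by the
well-foundedness of the labels, so that loops have to be filled separately. Every local branching
has a strictly decreasing diagram whose square is filled by the completion. Critical branchings have
one by construction, contexts carry it to all overlapping branchings, and the Peiffer hypothesis
together with the exchange law gives it for Peiffer branchings
(`isCoherentlyDecreasingAt_of_isCritical`). Pasting such squares turns a peak into a congruent
valley. The process stops because each square replaces two labels by smaller ones, so the multiset
of labels decreases in the Dershowitz-Manna order (`exists_valley_of_peak`). Consequently every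
zigzag is congruent to a valley (`exists_valley`). Two nonempty parallel sequences form a peak whose
valley is again a parallel pair, with a smaller multiset of labels. Iterating ends when one member
is empty, and the other is then a loop (`congr_of_parallel`). Loops are trivial modulo the
completion because they reduce to elementary ones by cutting and by removing contexts
(`congr_id_of_isElementary`). Finally, for parallel `f` and `g`, a valley congruent to `f ≫ g⁻¹` has
parallel legs, hence is trivial. -/

/-- A property of the morphisms of a free groupoid holds if it holds for identities and is stable
under composition on the right with generators and their inverses. -/
theorem CategoryTheory.FreeGroupoid.hom_induction {C : Type*} [Category* C]
    {P : ∀ {X Y : C}, (FreeGroupoid.mk X ⟶ FreeGroupoid.mk Y) → Prop}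
    (id : ∀ X : C, P (𝟙 (FreeGroupoid.mk X)))
    (comp : ∀ {X Y Z : C} (h : FreeGroupoid.mk X ⟶ FreeGroupoid.mk Y) (f : Y ⟶ Z),
      P h → P (h ≫ FreeGroupoid.homMk f))
    (comp_inv : ∀ {X Y Z : C} (h : FreeGroupoid.mk X ⟶ FreeGroupoid.mk Y) (f : Z ⟶ Y),
      P h → P (h ≫ Groupoid.inv (FreeGroupoid.homMk f)))
    {X Y : C} (h : FreeGroupoid.mk X ⟶ FreeGroupoid.mk Y) : P h := by
  -- A morphism is represented by a zigzag, a path in the symmetrised quiver, and induction on paths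
  -- applies.
  obtain ⟨⟨h⟩⟩ := h
  change @Quiver.Path (Quiver.Symmetrify C) _ X Y at h
  clear * - id comp comp_inv h
  induction h with
  | nil => exact id X
  | cons p e ih =>
    rcases e with e | e
    · exact comp _ e ih
    · exact comp_inv _ e ih

/-! ### The Dershowitz-Manna order and its reflexive closure -/

namespace Multiset

variable {α : Type*} [Preorder α]

theorem IsDershowitzMannaLT.add_right {M N : Multiset α} (h : M.IsDershowitzMannaLT N)
    (K : Multiset α) : (M + K).IsDershowitzMannaLT (N + K) := by
  obtain ⟨X, Y, Z, hZ, rfl, rfl, hY⟩ := h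
  exact ⟨X + K, Y, Z, hZ, by abel, by abel, hY⟩

/-- The reflexive closure of the Dershowitz-Manna order. -/
def IsDershowitzMannaLE (M N : Multiset α) : Prop := M = N ∨ M.IsDershowitzMannaLT N

theorem IsDershowitzMannaLE.refl (M : Multiset α) : M.IsDershowitzMannaLE M := .inl rfl

theorem IsDershowitzMannaLE.trans_lt {M N K : Multiset α} (h : M.IsDershowitzMannaLE N)
    (h' : N.IsDershowitzMannaLT K) : M.IsDershowitzMannaLT K := by
  obtain rfl | h := h
  · exact h'
  · exact h.trans h'

theorem IsDershowitzMannaLE.trans {M N K : Multiset α} (h : M.IsDershowitzMannaLE N)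
    (h' : N.IsDershowitzMannaLE K) : M.IsDershowitzMannaLE K := by
  obtain rfl | h' := h'
  · exact h
  · exact .inr (h.trans_lt h')

theorem IsDershowitzMannaLE.add_right {M N : Multiset α} (h : M.IsDershowitzMannaLE N)
    (K : Multiset α) : (M + K).IsDershowitzMannaLE (N + K) := by
  obtain rfl | h := h
  · exact .refl _
  · exact .inr (h.add_right K)

theorem isDershowitzMannaLE_add_right (M K : Multiset α) : M.IsDershowitzMannaLE (M + K) := by
  by_cases hK : K = 0
  · subst hK; exact .inl (add_zero M).symm
  · exact .inr ⟨M, 0, K, hK, by simp, rfl, by simp⟩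

end Multiset

/-! ### Rewriting sequences and the number of steps of a 2-cell -/

namespace TwoPolygraph

variable {S : TwoPolygraph.{u, v, w}}

namespace OneCell

variable {x y z : S.Ob}

@[simp] theorem length_comp (p : S.OneCell x y) (q : S.OneCell y z) :
    (p.comp q).length = p.length + q.length :=
  Quiver.Path.length_comp p q

end OneCell

namespace RewSeq

variable {x y : S.Ob} {p q r : S.OneCell x y}

@[simp] theorem toInv_nil : toInv (.nil : S.RewSeq p p) = 𝟙 _ :=
  (FreeGroupoid.of _).map_id _

@[simp] theorem toTwoCell_comp (f : S.RewSeq p q) (g : S.RewSeq q r) :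
    toTwoCell (f.comp g) = toTwoCell f ≫ toTwoCell g := rfl

@[simp] theorem toInv_comp (f : S.RewSeq p q) (g : S.RewSeq q r) :
    toInv (f.comp g) = toInv f ≫ toInv g :=
  (FreeGroupoid.of _).map_comp f.toTwoCell g.toTwoCell

theorem toTwoCell_surjective : Function.Surjective (toTwoCell : S.RewSeq p q → S.TwoCell p q) := by
  rintro ⟨f⟩
  exact ⟨f, rfl⟩

theorem whisker_comp {a b : S.Ob} (u : S.OneCell a x) (f : S.RewSeq p q) (g : S.RewSeq q r)
    (v : S.OneCell y b) : whisker u (f.comp g) v = (whisker u f v).comp (whisker u g v) :=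
  (whiskerPrefunctor u v).mapPath_comp f g

/-- A nonempty rewriting sequence starts with a rewriting step. -/
theorem eq_nil_or_eq_toSeq_comp (f : S.RewSeq p q) :
    (∃ h : p = q, f = h ▸ .nil) ∨ ∃ (r : S.OneCell x y) (e : S.Step p r) (f' : S.RewSeq r q),
      f = e.toSeq.comp f' := by
  induction f with
  | nil => exact .inl ⟨rfl, rfl⟩
  | cons f e ih =>
    right
    obtain ⟨rfl, rfl⟩ | ⟨r, e', f', rfl⟩ := ih
    · exact ⟨_, e, .nil, rfl⟩
    · exact ⟨r, e', f'.cons e, rfl⟩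

end RewSeq

namespace TwoCell

variable {x y : S.Ob} {p q r : S.OneCell x y}

@[simp] theorem toInv_id : toInv (𝟙 _ : S.TwoCell p p) = 𝟙 _ := (FreeGroupoid.of _).map_id _

@[simp] theorem toInv_comp (f : S.TwoCell p q) (g : S.TwoCell q r) :
    toInv (f ≫ g) = toInv f ≫ toInv g :=
  (FreeGroupoid.of _).map_comp _ _

variable (S) in
/-- The functor that counts the steps of a `2`-cell. -/
def lengthFunctor (x y : S.Ob) : S.HomCat x y ⥤ SingleObj (Multiplicative ℕ) :=
  CategoryTheory.Quotient.lift _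
    (Paths.lift { obj := fun _ => SingleObj.star _, map := fun _ => Multiplicative.ofAdd 1 })
    -- Both sides of an exchange relation consist of two steps.
    (by rintro _ _ _ _ ⟨f, g, _, _, _, _⟩; rfl)

/-- The number of steps of a `2`-cell. -/
def length (f : S.TwoCell p q) : ℕ := Multiplicative.toAdd ((lengthFunctor S x y).map f)

@[simp] theorem length_comp (f : S.TwoCell p q) (g : S.TwoCell q r) :
    length (f ≫ g) = length f + length g := by
  simp only [length, Functor.map_comp, SingleObj.comp_as_mul]
  -- Composition in `SingleObj` is multiplication in the opposite order.
  exact add_comm _ _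

theorem length_toTwoCell (f : S.RewSeq p q) : length f.toTwoCell = Quiver.Path.length f := by
  induction f with
  | nil => rfl
  | cons f e ih =>
    change length (RewSeq.toTwoCell (Quiver.Path.comp f e.toSeq)) = _
    rw [RewSeq.toTwoCell_comp, length_comp, ih]
    rfl

theorem eq_of_length_eq_zero (f : S.TwoCell p q) (h : length f = 0) : p = q := by
  obtain ⟨f, rfl⟩ := RewSeq.toTwoCell_surjective f
  exact Quiver.Path.eq_of_length_zero f (length_toTwoCell f ▸ h)

theorem eq_id_of_length_eq_zero (f : S.TwoCell p p) (h : length f = 0) : f = 𝟙 _ := by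
  obtain ⟨f, rfl⟩ := RewSeq.toTwoCell_surjective f
  rw [Quiver.Path.eq_nil_of_length_zero f (length_toTwoCell f ▸ h)]
  rfl

theorem length_whisker {a b : S.Ob} (u : S.OneCell a x) (f : S.TwoCell p q) (v : S.OneCell y b) :
    length (whisker u f v) = length f := by
  obtain ⟨f, rfl⟩ := RewSeq.toTwoCell_surjective f
  change length (RewSeq.toTwoCell (RewSeq.whisker u f v)) = _
  simp only [length_toTwoCell]
  induction f with
  | nil => rfl
  | cons f e ih => exact congrArg (· + 1) ih

end TwoCell

/-! ### Cancellation in the congruence generated by the 3-cells -/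

namespace GlobularExtension

variable {Γ : S.GlobularExtension} {x y : S.Ob} {p q r : S.OneCell x y}

theorem Congr.of_eq {f g : S.InvTwoCell p q} (h : f = g) : Γ.Congr f g := h ▸ .refl f

theorem Congr.comp_left (f : S.InvTwoCell p q) {g g' : S.InvTwoCell q r} (h : Γ.Congr g g') :
    Γ.Congr (f ≫ g) (f ≫ g') := .comp (.refl f) h

theorem Congr.comp_right {f f' : S.InvTwoCell p q} (h : Γ.Congr f f') (g : S.InvTwoCell q r) :
    Γ.Congr (f ≫ g) (f' ≫ g) := .comp h (.refl g)

theorem congr_comp_left_iff (f : S.InvTwoCell p q) {g g' : S.InvTwoCell q r} :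
    Γ.Congr (f ≫ g) (f ≫ g') ↔ Γ.Congr g g' :=
  ⟨fun h => by simpa using h.comp_left (Groupoid.inv f), .comp_left f⟩

theorem congr_comp_right_iff {f f' : S.InvTwoCell p q} (g : S.InvTwoCell q r) :
    Γ.Congr (f ≫ g) (f' ≫ g) ↔ Γ.Congr f f' :=
  ⟨fun h => by simpa using h.comp_right (Groupoid.inv g), fun h => .comp_right h g⟩

theorem congr_comp_inv_id_iff {f g : S.InvTwoCell p q} :
    Γ.Congr (f ≫ Groupoid.inv g) (𝟙 _) ↔ Γ.Congr f g := by
  rw [← congr_comp_right_iff g]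
  simp

theorem congr_inv_comp_id_iff {f g : S.InvTwoCell p q} :
    Γ.Congr (Groupoid.inv f ≫ g) (𝟙 _) ↔ Γ.Congr g f := by
  rw [← congr_comp_left_iff f]
  simp

/-- Congruent `2`-cells are related by a `3`-cell. -/
theorem Congr.nonempty_threeCell {f g : S.InvTwoCell p q} (h : Γ.Congr f g) :
    Nonempty (Γ.ThreeCell f g) := by
  induction h with
  | of A => exact ⟨.of A⟩
  | refl f => exact ⟨.id f⟩
  | symm _ ih => exact ih.map .inv
  | trans _ _ ih ih' => exact ih.elim fun A => ih'.map A.comp₂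
  | comp _ _ ih ih' => exact ih.elim fun A => ih'.map A.comp₁
  | whisker u v _ ih => exact ih.map (.whisker u v)

end GlobularExtension

/-! ### Contexts of branchings and reduction to critical ones -/

namespace LocalBranching

/-- Associativity and unit laws of paths make the endpoints equal only propositionally; the casts
absorb this in the comparisons of whiskered branchings below. -/
theorem mk_eq_mk {x y : S.Ob} {p q r p' q' r' : S.OneCell x y} {f : S.Step p q} {g : S.Step p r}
    {f' : S.Step p' q'} {g' : S.Step p' r'} (hp : p = p') (hq : q = q') (hr : r = r')
    (hf : f' = f.cast hp hq) (hg : g' = g.cast hp hr) :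
    (⟨f', g'⟩ : S.LocalBranching) = ⟨f, g⟩ := by
  subst hp hq hr hf hg
  rfl

theorem whisker_nil (b : S.LocalBranching) : b.whisker .nil .nil = b := by
  have e (p : S.OneCell b.x b.y) : p = OneCell.comp .nil (p.comp .nil) :=
    (Quiver.Path.nil_comp p).symm
  have h {p q : S.OneCell b.x b.y} (f : S.Step p q) :
      Step.whisker .nil f .nil = f.cast (e p) (e q) :=
    Step.mk_eq (Quiver.Path.nil_comp _) rfl _ _ _ _
  exact mk_eq_mk _ _ _ (h _) (h _)

theorem whisker_whisker (b : S.LocalBranching) {x₁ y₁ x₂ y₂ : S.Ob} (u₂ : S.OneCell x₂ b.x)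
    (v₂ : S.OneCell b.y y₂) (u₁ : S.OneCell x₁ x₂) (v₁ : S.OneCell y₂ y₁) :
    (b.whisker u₂ v₂).whisker u₁ v₁ = b.whisker (u₁.comp u₂) (v₂.comp v₁) := by
  have e (p : S.OneCell b.x b.y) :
      (u₁.comp u₂).comp (p.comp (v₂.comp v₁)) = u₁.comp ((u₂.comp (p.comp v₂)).comp v₁) := by
    simp only [OneCell.comp_assoc]
  have h {p q : S.OneCell b.x b.y} (f : S.Step p q) :
      Step.whisker u₁ (Step.whisker u₂ f v₂) v₁ =
        (Step.whisker (u₁.comp u₂) f (v₂.comp v₁)).cast (e p) (e q) :=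
    Step.mk_eq (OneCell.comp_assoc _ _ _).symm (OneCell.comp_assoc _ _ _) _ _ _ _
  exact mk_eq_mk _ _ _ (h _) (h _)

theorem whisker_peiffer {x y z x' y' : S.Ob} {p p' : S.OneCell x y} {q q' : S.OneCell y z}
    (f : S.Step p p') (g : S.Step q q') (u : S.OneCell x' x) (v : S.OneCell z y') :
    (peiffer f g).whisker u v = peiffer (f.whiskerLeft u) (g.whiskerRight v) := by
  have e (r : S.OneCell x y) (s : S.OneCell y z) :
      (u.comp r).comp (s.comp v) = u.comp ((r.comp s).comp v) := by
    simp only [OneCell.comp_assoc]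
  have h₁ : Step.whisker u (f.whiskerRight q) v =
      ((f.whiskerLeft u).whiskerRight (q.comp v)).cast (e _ _) (e _ _) :=
    Step.mk_eq rfl (OneCell.comp_assoc _ _ _) _ _ _ _
  have h₂ : Step.whisker u (g.whiskerLeft p) v =
      ((g.whiskerRight v).whiskerLeft (u.comp p)).cast (e _ _) (e _ _) :=
    Step.mk_eq (OneCell.comp_assoc _ _ _).symm rfl _ _ _ _
  exact mk_eq_mk _ _ _ h₁ h₂

theorem IsAspherical.whisker {b : S.LocalBranching} (h : b.IsAspherical) {x' y' : S.Ob}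
    (u : S.OneCell x' b.x) (v : S.OneCell b.y y') : (b.whisker u v).IsAspherical := by
  obtain ⟨_, _, _, _, f, rfl⟩ := h
  exact ⟨_, _, _, _, f.whisker u v, rfl⟩

theorem IsPeiffer.whisker {b : S.LocalBranching} (h : b.IsPeiffer) {x' y' : S.Ob}
    (u : S.OneCell x' b.x) (v : S.OneCell b.y y') : (b.whisker u v).IsPeiffer := by
  obtain ⟨x, y, z, p, p', q, q', f, g, rfl⟩ := h
  exact ⟨_, _, _, _, _, _, _, _, _, whisker_peiffer f g u v⟩

/-- Being aspherical or Peiffer persists in every context, so by contraposition overlapping descends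
to the branching inside a context. -/
theorem IsOverlapping.of_whisker {b : S.LocalBranching} {x' y' : S.Ob}
    {u : S.OneCell x' b.x} {v : S.OneCell b.y y'} (h : (b.whisker u v).IsOverlapping) :
    b.IsOverlapping :=
  ⟨fun hb => h.1 (hb.whisker u v), fun hb => h.2.1 (hb.whisker u v),
    fun hb => h.2.2 (hb.whisker (b := b.swap) u v)⟩

theorem length_src_whisker (b : S.LocalBranching) {x' y' : S.Ob} (u : S.OneCell x' b.x)
    (v : S.OneCell b.y y') :
    (b.whisker u v).src.length = u.length + (b.src.length + v.length) := by
  change (u.comp (b.src.comp v)).length = _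
  simp

theorem whisker_eq_self_of_length {b : S.LocalBranching} {x' y' : S.Ob} (u : S.OneCell x' b.x)
    (v : S.OneCell b.y y') (hu : u.length = 0) (hv : v.length = 0) : b.whisker u v = b := by
  obtain rfl := Quiver.Path.eq_of_length_zero u hu
  obtain rfl := Quiver.Path.eq_of_length_zero v hv
  obtain rfl := Quiver.Path.eq_nil_of_length_zero u hu
  obtain rfl := Quiver.Path.eq_nil_of_length_zero v hv
  exact whisker_nil b

/-- Every overlapping branching is obtained from a critical one by composition with a context. -/
theorem IsOverlapping.exists_isCritical {b : S.LocalBranching} (h : b.IsOverlapping) :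
    ∃ c : S.LocalBranching, c.IsCritical ∧ c.ContextLE b := by
  classical
  -- Among the overlapping branchings below `b`, one with shortest source is minimal: a branching
  -- `d` below it is still overlapping and below `b`, so its source cannot be shorter and the
  -- context is trivial.
  have hex : ∃ n, ∃ c : S.LocalBranching, c.IsOverlapping ∧ c.ContextLE b ∧ c.src.length = n :=
    ⟨_, b, h, ⟨_, _, .nil, .nil, (whisker_nil b).symm⟩, rfl⟩
  obtain ⟨c, hc, ⟨x₁, y₁, u₁, v₁, rfl⟩, hn⟩ := Nat.find_spec hex
  refine ⟨c, ⟨hc, ?_⟩, ⟨_, _, u₁, v₁, rfl⟩⟩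
  rintro d ⟨x₂, y₂, u₂, v₂, rfl⟩
  have hle := Nat.find_min' hex ⟨d, hc.of_whisker, ⟨_, _, _, _, whisker_whisker _ _ _ _ _⟩, rfl⟩
  rw [← hn, length_src_whisker] at hle
  exact (whisker_eq_self_of_length u₂ v₂ (by omega) (by omega)).symm

end LocalBranching

namespace GlobularExtension

/-- The square of a confluence diagram is filled in if and only if the zigzag over the branching is
congruent to the zigzag under it. -/
theorem congr_side_iff {Γ : S.GlobularExtension} {b : S.LocalBranching} (D : Confluence b) :
    Γ.Congr D.side₁.toInv D.side₂.toInv ↔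
      Γ.Congr (Groupoid.inv b.fst.toSeq.toInv ≫ b.snd.toSeq.toInv)
        (D.fst.toInv ≫ Groupoid.inv D.snd.toInv) := by
  rw [← congr_comp_left_iff b.fst.toSeq.toInv, ← congr_comp_right_iff D.snd.toInv]
  simp only [Confluence.side₁, Confluence.side₂, RewSeq.toInv_comp, Category.assoc,
    Groupoid.inv_eq_inv, IsIso.hom_inv_id_assoc, IsIso.inv_hom_id, Category.comp_id]
  exact ⟨.symm, .symm⟩

theorem Congr.whisker_side {Γ : S.GlobularExtension} {b : S.LocalBranching} {D : Confluence b}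
    (h : Γ.Congr D.side₁.toInv D.side₂.toInv) {x' y' : S.Ob} (u : S.OneCell x' b.x)
    (v : S.OneCell b.y y') :
    Γ.Congr (D.whisker u v).side₁.toInv (D.whisker u v).side₂.toInv := by
  have e₁ : (D.whisker u v).side₁ = RewSeq.whisker u D.side₁ v :=
    (RewSeq.whisker_comp u b.fst.toSeq D.fst v).symm
  have e₂ : (D.whisker u v).side₂ = RewSeq.whisker u D.side₂ v :=
    (RewSeq.whisker_comp u b.snd.toSeq D.snd v).symm
  rw [e₁, e₂]
  exact h.whisker u v

end GlobularExtension

/-! ### Filled strictly decreasing diagrams for all local branchings -/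

namespace Labelling

variable {W : Type*}

/-- The multiset of labels of the steps of a rewriting sequence. -/
def labelMultiset (ψ : S.Labelling W) {x y : S.Ob} {p : S.OneCell x y} :
    ∀ {q : S.OneCell x y}, S.RewSeq p q → Multiset W
  | _, .nil => 0
  | _, .cons f e => labelMultiset ψ f + {ψ e}

section

variable (ψ : S.Labelling W) {x y : S.Ob} {p q r : S.OneCell x y}

@[simp] theorem labelMultiset_nil : ψ.labelMultiset (.nil : S.RewSeq p p) = 0 := rfl

@[simp] theorem labelMultiset_toSeq (e : S.Step p q) : ψ.labelMultiset e.toSeq = {ψ e} :=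
  zero_add _

@[simp] theorem labelMultiset_comp (f : S.RewSeq p q) (g : S.RewSeq q r) :
    ψ.labelMultiset (f.comp g) = ψ.labelMultiset f + ψ.labelMultiset g := by
  induction g with
  | nil => exact (add_zero _).symm
  | cons g e ih => exact (congrArg (· + {ψ e}) ih).trans (add_assoc _ _ _)

theorem mem_labelMultiset {k : W} (f : S.RewSeq p q) :
    k ∈ ψ.labelMultiset f ↔ k ∈ ψ.labels f := by
  induction f with
  | nil => simp [labels]
  | cons f e ih => simp [labels, labelMultiset, ih, or_comm]

end

variable [PartialOrder W]

/-- The local branching has a strictly decreasing confluence diagram that is filled in by `Γ`. -/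
def IsCoherentlyDecreasingAt (ψ : S.Labelling W) (Γ : S.GlobularExtension)
    (b : S.LocalBranching) : Prop :=
  ∃ D : Confluence b, ψ.IsStrictlyDecreasingDiagram D ∧ Γ.Congr D.side₁.toInv D.side₂.toInv

variable {ψ : S.Labelling W} {Γ : S.GlobularExtension}

theorem IsCoherentlyDecreasingAt.swap {b : S.LocalBranching}
    (h : ψ.IsCoherentlyDecreasingAt Γ b) : ψ.IsCoherentlyDecreasingAt Γ b.swap := by
  obtain ⟨D, ⟨h₁, h₂⟩, hD⟩ := h
  exact ⟨⟨D.snd, D.fst⟩, ⟨h₂, h₁⟩, hD.symm⟩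

theorem IsCoherentlyDecreasingAt.whisker (hψ : ψ.IsCompatibleWithContexts) {b : S.LocalBranching}
    (h : ψ.IsCoherentlyDecreasingAt Γ b) {x' y' : S.Ob} (u : S.OneCell x' b.x)
    (v : S.OneCell b.y y') : ψ.IsCoherentlyDecreasingAt Γ (b.whisker u v) := by
  obtain ⟨D, hD, hΓ⟩ := h
  exact ⟨D.whisker u v, hψ b D hD _ _ u v, hΓ.whisker_side u v⟩

theorem IsCoherentlyDecreasingAt.of_isAspherical {b : S.LocalBranching} (h : b.IsAspherical) :
    ψ.IsCoherentlyDecreasingAt Γ b := by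
  obtain ⟨_, _, _, _, f, rfl⟩ := h
  exact ⟨⟨.nil, .nil⟩, ⟨fun _ hk => hk.elim, fun _ hk => hk.elim⟩, .refl _⟩

/-- The exchange law rewrites the zigzag over the branching as the zigzag through the far corner of
the Peiffer square, which the hypothesis relates to the decreasing diagram. -/
theorem IsCoherentlyDecreasingAt.of_isPeiffer (hψ : ψ.IsPeifferDecreasing Γ)
    {b : S.LocalBranching} (h : b.IsPeiffer) : ψ.IsCoherentlyDecreasingAt Γ b := by
  obtain ⟨x, y, z, p, p', q, q', f, g, rfl⟩ := h
  obtain ⟨D, hD, hΓ⟩ := hψ f g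
  refine ⟨D, hD, (GlobularExtension.congr_side_iff D).2 (.trans (.of_eq ?_) hΓ)⟩
  have key : (f.whiskerRight q).toSeq.toInv ≫ (g.whiskerLeft p').toSeq.toInv =
      (g.whiskerLeft p).toSeq.toInv ≫ (f.whiskerRight q').toSeq.toInv := by
    rw [← RewSeq.toInv_comp, ← RewSeq.toInv_comp]
    exact congrArg TwoCell.toInv
      (CategoryTheory.Quotient.sound _ (PeifferRel.exchange f g rfl rfl rfl rfl))
  change Groupoid.inv (f.whiskerRight q).toSeq.toInv ≫ (g.whiskerLeft p).toSeq.toInv = _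
  rw [Groupoid.inv_eq_inv, Groupoid.inv_eq_inv, IsIso.inv_comp_eq, ← Category.assoc,
    IsIso.eq_comp_inv]
  exact key.symm

/-- Under the hypotheses of compatibility with contexts and Peiffer decreasingness, all local
branchings have coherent strictly decreasing diagrams as soon as the critical ones do. -/
theorem isCoherentlyDecreasingAt_of_isCritical (hctx : ψ.IsCompatibleWithContexts)
    (hpeiffer : ψ.IsPeifferDecreasing Γ)
    (hcrit : ∀ b : S.LocalBranching, b.IsCritical → ψ.IsCoherentlyDecreasingAt Γ b)
    (b : S.LocalBranching) : ψ.IsCoherentlyDecreasingAt Γ b := by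
  by_cases h₁ : b.IsAspherical
  · exact .of_isAspherical h₁
  by_cases h₂ : b.IsPeiffer
  · exact .of_isPeiffer hpeiffer h₂
  by_cases h₃ : b.swap.IsPeiffer
  · exact (IsCoherentlyDecreasingAt.of_isPeiffer hpeiffer h₃).swap
  obtain ⟨c, hc, _, _, u, v, rfl⟩ := LocalBranching.IsOverlapping.exists_isCritical ⟨h₁, h₂, h₃⟩
  exact (hcrit c hc).whisker hctx u v

/-- The completion chooses only one of `b` and `b.swap`; the other one uses the mirrored diagram and
the inverse 3-cell. -/
theorem isCoherentlyDecreasingAt_squierCompletion_of_isCritical (O : ψ.GeneratingConfluences)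
    (L : S.LoopExtension) {b : S.LocalBranching} (hb : b.IsCritical) :
    ψ.IsCoherentlyDecreasingAt (squierCompletion O L) b := by
  have h (c : O.carrier) : ψ.IsCoherentlyDecreasingAt (squierCompletion O L) c.1 :=
    ⟨O.diagram c, O.decreasing c,
      GlobularExtension.Congr.of (Γ := squierCompletion O L) (Sum.inl c)⟩
  obtain ⟨h', -⟩ | ⟨h', -⟩ := O.exactly_one b hb
  · exact h ⟨b, h'⟩
  · exact (h ⟨b.swap, h'⟩).swap

/-- The labels of a strictly decreasing diagram are bounded by those of its branching. -/
theorem IsStrictlyDecreasingDiagram.isDershowitzMannaLT {b : S.LocalBranching} {D : Confluence b}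
    (h : ψ.IsStrictlyDecreasingDiagram D) :
    (ψ.labelMultiset D.fst + ψ.labelMultiset D.snd).IsDershowitzMannaLT
      ({ψ b.fst} + {ψ b.snd}) := by
  -- No label is kept: the common part is empty, and each new label lies below the label of the step
  -- on its own side.
  refine ⟨0, _, _, by simp, (zero_add _).symm, (zero_add _).symm, fun k hk => ?_⟩
  obtain hk | hk := Multiset.mem_add.1 hk
  · exact ⟨_, by simp, h.1 k ((mem_labelMultiset ψ _).1 hk)⟩
  · exact ⟨_, by simp, h.2 k ((mem_labelMultiset ψ _).1 hk)⟩

/-! ### From peaks to valleys -/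

/-- Peaks of rewriting sequences are congruent to valleys whose multiset of labels is not larger,
and is smaller if both branches of the peak are nonempty. -/
theorem exists_valley_of_peak [WellFoundedLT W] (hloc : ∀ b, ψ.IsCoherentlyDecreasingAt Γ b)
    {x y : S.Ob} {p q r : S.OneCell x y} (f : S.RewSeq p q) (g : S.RewSeq p r) :
    ∃ (t : S.OneCell x y) (f' : S.RewSeq q t) (g' : S.RewSeq r t),
      Γ.Congr (Groupoid.inv f.toInv ≫ g.toInv) (f'.toInv ≫ Groupoid.inv g'.toInv) ∧
      (ψ.labelMultiset f' + ψ.labelMultiset g').IsDershowitzMannaLE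
        (ψ.labelMultiset f + ψ.labelMultiset g) ∧
      (Quiver.Path.length f ≠ 0 → Quiver.Path.length g ≠ 0 →
        (ψ.labelMultiset f' + ψ.labelMultiset g').IsDershowitzMannaLT
          (ψ.labelMultiset f + ψ.labelMultiset g)) := by
  generalize hM : ψ.labelMultiset f + ψ.labelMultiset g = M
  have hwf := Multiset.wellFounded_isDershowitzMannaLT (α := W)
  induction M using hwf.induction generalizing p q r with
  | _ M ih =>
  obtain ⟨rfl, rfl⟩ | ⟨q₁, e₁, f₂, rfl⟩ := f.eq_nil_or_eq_toSeq_comp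
  -- A peak with an empty branch is already a valley with the same labels, hence the nonstrict bound
  -- in general.
  · refine ⟨r, g, .nil, .of_eq (by simp), .inl (by simpa using hM), fun h => absurd rfl h⟩
  obtain ⟨rfl, rfl⟩ | ⟨r₁, e₂, g₂, rfl⟩ := g.eq_nil_or_eq_toSeq_comp
  · refine ⟨q, .nil, e₁.toSeq.comp f₂, .of_eq (by simp), .inl ?_, fun _ h => absurd rfl h⟩
    rw [← hM, add_comm]
    rfl
  obtain ⟨D, hD, hΓ⟩ := hloc ⟨e₁, e₂⟩
  rw [GlobularExtension.congr_side_iff] at hΓ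
  have hlt := hD.isDershowitzMannaLT
  obtain @⟨t₁, f₁', g₁'⟩ := D
  dsimp only at f₁' g₁' hΓ hlt
  simp only [labelMultiset_comp, labelMultiset_toSeq] at hM
  set F := ψ.labelMultiset f₂
  set G := ψ.labelMultiset g₂
  -- The local square trades the labels of `e₁` and `e₂` for smaller ones, while those of `f₂` and
  -- `g₂` stay.
  have hlt' : (F + ψ.labelMultiset f₁' + (ψ.labelMultiset g₁' + G)).IsDershowitzMannaLT M := by
    convert hlt.add_right (F + G) using 1
    · abel
    · rw [← hM]
      abel
  -- The peak of `f₂` and `f₁'` is closed first. Its nonstrict bound `hle` controls the labels of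
  -- `b`, which enter the second peak, formed by `g₁' · b` and `g₂`.
  obtain ⟨t₂, a, b, hab, hle, -⟩ := ih _ ((Multiset.isDershowitzMannaLE_add_right _ _).trans_lt hlt')
    f₂ f₁' rfl
  have hle' := hle.add_right (ψ.labelMultiset g₁' + G)
  have hle'' : (ψ.labelMultiset (g₁'.comp b) + G).IsDershowitzMannaLE
      (ψ.labelMultiset a + ψ.labelMultiset b + (ψ.labelMultiset g₁' + G)) := by
    convert Multiset.isDershowitzMannaLE_add_right _ (ψ.labelMultiset a) using 1
    rw [labelMultiset_comp]
    abel
  obtain ⟨t₃, c, d, hcd, hle₃, -⟩ := ih _ ((hle''.trans hle').trans_lt hlt') (g₁'.comp b) g₂ rfl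
  -- The leg `a` takes no part in the second peak, so its labels are added to both sides of `hle₃`.
  have hfin : (ψ.labelMultiset (a.comp c) + ψ.labelMultiset d).IsDershowitzMannaLT M := by
    refine Multiset.IsDershowitzMannaLE.trans_lt ?_ (hle'.trans_lt hlt')
    convert hle₃.add_right (ψ.labelMultiset a) using 1
    · rw [labelMultiset_comp]
      abel
    · rw [labelMultiset_comp]
      abel
  refine ⟨t₃, a.comp c, d, ?_, .inr hfin, fun _ _ => hfin⟩
  have h₁ := (hΓ.comp_left (Groupoid.inv f₂.toInv)).comp_right g₂.toInv
  have h₂ := hab.comp_right (Groupoid.inv g₁'.toInv ≫ g₂.toInv)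
  have h₃ := hcd.comp_left a.toInv
  simp only [RewSeq.toInv_comp, Groupoid.inv_eq_inv, IsIso.inv_comp, Category.assoc] at h₁ h₂ h₃ ⊢
  exact h₁.trans (h₂.trans h₃)

/-- Every `2`-cell of the free `(2,1)`-category is congruent to a valley. -/
theorem exists_valley [WellFoundedLT W] (hloc : ∀ b, ψ.IsCoherentlyDecreasingAt Γ b)
    {x y : S.Ob} {p q : S.OneCell x y} (h : S.InvTwoCell p q) :
    ∃ (t : S.OneCell x y) (f : S.RewSeq p t) (g : S.RewSeq q t),
      Γ.Congr h (f.toInv ≫ Groupoid.inv g.toInv) := by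
  refine FreeGroupoid.hom_induction (C := S.HomCat x y)
    (P := fun {p q} h => ∃ (t : S.OneCell x y) (f : S.RewSeq p.as t) (g : S.RewSeq q.as t),
      Γ.Congr h (f.toInv ≫ Groupoid.inv g.toInv)) ?_ ?_ ?_ h
  · exact fun p => ⟨p.as, .nil, .nil, .of_eq (by simp)⟩
  · rintro ⟨(p : S.OneCell x y)⟩ ⟨(q : S.OneCell x y)⟩ ⟨(r : S.OneCell x y)⟩ h k ⟨t, f, g, hfg⟩
    obtain ⟨k, rfl⟩ := RewSeq.toTwoCell_surjective k
    change S.RewSeq p t at f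
    change S.RewSeq q t at g
    -- A forward step after a valley creates a peak with its right leg, which is converted; a
    -- backward step, in the next case, merely lengthens that leg.
    obtain ⟨t', a, b, hab, -⟩ := exists_valley_of_peak hloc g k
    refine ⟨t', Quiver.Path.comp f a, b, (hfg.comp_right _).trans ?_⟩
    change Γ.Congr ((f.toInv ≫ Groupoid.inv g.toInv) ≫ k.toInv) _
    have := hab.comp_left f.toInv
    rwa [← Category.assoc, ← Category.assoc, ← RewSeq.toInv_comp] at this
  · rintro ⟨(p : S.OneCell x y)⟩ ⟨(q : S.OneCell x y)⟩ ⟨(r : S.OneCell x y)⟩ h k ⟨t, f, g, hfg⟩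
    obtain ⟨k, rfl⟩ := RewSeq.toTwoCell_surjective k
    change S.RewSeq p t at f
    change S.RewSeq q t at g
    refine ⟨t, f, Quiver.Path.comp k g, (hfg.comp_right _).trans (.of_eq ?_)⟩
    change (f.toInv ≫ Groupoid.inv g.toInv) ≫ Groupoid.inv k.toInv =
      f.toInv ≫ Groupoid.inv (RewSeq.toInv (Quiver.Path.comp k g))
    rw [RewSeq.toInv_comp]
    simp

/-- If all `2`-loops are congruent to identities, then parallel rewriting sequences are
congruent. -/
theorem congr_of_parallel [WellFoundedLT W] (hloc : ∀ b, ψ.IsCoherentlyDecreasingAt Γ b)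
    (hloop : ∀ f : S.Loop, Γ.Congr (TwoCell.toInv f.cell) (𝟙 _))
    {x y : S.Ob} {p q : S.OneCell x y} (f g : S.RewSeq p q) : Γ.Congr f.toInv g.toInv := by
  generalize hM : ψ.labelMultiset f + ψ.labelMultiset g = M
  have hwf := Multiset.wellFounded_isDershowitzMannaLT (α := W)
  induction M using hwf.induction generalizing p q with
  | _ M ih =>
  by_cases hf : Quiver.Path.length f = 0
  · obtain rfl := Quiver.Path.eq_of_length_zero f hf
    obtain rfl := Quiver.Path.eq_nil_of_length_zero f hf
    rw [RewSeq.toInv_nil]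
    exact (hloop ⟨g.toTwoCell⟩).symm
  by_cases hg : Quiver.Path.length g = 0
  · obtain rfl := Quiver.Path.eq_of_length_zero g hg
    obtain rfl := Quiver.Path.eq_nil_of_length_zero g hg
    rw [RewSeq.toInv_nil]
    exact hloop ⟨f.toTwoCell⟩
  obtain ⟨t, f', g', h, -, hlt⟩ := exists_valley_of_peak hloc f g
  -- As `f` and `g` share their target, the legs of the valley are parallel; the strict bound,
  -- available since both sequences are nonempty, permits induction.
  have key := ih _ (hM ▸ hlt hf hg) f' g' rfl
  exact (GlobularExtension.congr_inv_comp_id_iff.1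
    (h.trans (GlobularExtension.congr_comp_inv_id_iff.2 key))).symm

end Labelling

/-! ### Reduction of loops to elementary ones -/

namespace Loop

variable {Γ : S.GlobularExtension}

/-- Rotation is conjugation: composing `h k ≡ 1` with `k` on the left and `k h ≡ 1` with `k` on the
right yields the same relation `k h k ≡ k`. -/
theorem Rotation.congr_id_iff {f g : S.Loop} (h : Rotation f g) :
    Γ.Congr (TwoCell.toInv f.cell) (𝟙 _) ↔ Γ.Congr (TwoCell.toInv g.cell) (𝟙 _) := by
  obtain ⟨h, k⟩ := h
  simp only [RewSeq.toTwoCell_comp, TwoCell.toInv_comp]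
  rw [← GlobularExtension.congr_comp_left_iff (TwoCell.toInv k.toTwoCell),
    ← GlobularExtension.congr_comp_right_iff (f' := 𝟙 _) (TwoCell.toInv k.toTwoCell)]
  simp

theorem congr_id_iff_of_toClass_eq {f g : S.Loop} (h : f.toClass = g.toClass) :
    Γ.Congr (TwoCell.toInv f.cell) (𝟙 _) ↔ Γ.Congr (TwoCell.toInv g.cell) (𝟙 _) := by
  replace h := Quot.eqvGen_exact h
  induction h with
  | rel _ _ h => exact h.congr_id_iff
  | refl _ => rfl
  | symm _ _ _ ih => exact ih.symm
  | trans _ _ _ _ _ ih ih' => exact ih.trans ih'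

/-- If the elementary `2`-loops are congruent to identities, then so are all `2`-loops. -/
theorem congr_id_of_isElementary
    (hΓ : ∀ f : S.Loop, f.IsElementary → Γ.Congr (TwoCell.toInv f.cell) (𝟙 _)) (f : S.Loop) :
    Γ.Congr (TwoCell.toInv f.cell) (𝟙 _) := by
  by_cases h₁ : f.IsIdentity
  · exact .of_eq (by rw [h₁, TwoCell.toInv_id])
  by_cases h₂ : f.IsMinimalForComp
  · by_cases h₃ : f.IsMinimalByContext
    · exact hΓ f ⟨h₁, h₂, h₃⟩
    · obtain ⟨a, b, g, u, v, huv, hf⟩ := not_not.1 h₃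
      have hlen : f.cell.length = g.cell.length := by
        rw [hf]
        exact TwoCell.length_whisker _ _ _
      have hbase : f.base.length = u.length + (g.base.length + v.length) := by
        rw [hf]
        change (u.comp (g.base.comp v)).length = _
        simp
      have key := (congr_id_of_isElementary hΓ g).whisker u v
      rw [hf]
      exact key.trans (.of_eq ((FreeGroupoid.map (whiskerFunctor u v)).map_id _))
  · simp only [IsMinimalForComp, not_forall, not_or] at h₂
    obtain ⟨q, g, h, k, hf, hh, hne⟩ := h₂
    have hlen : f.cell.length = g.length + (h.length + k.length) := by
      rw [hf, TwoCell.length_comp, TwoCell.length_comp]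
    have hpos : h.length ≠ 0 := fun h0 => hh (TwoCell.eq_id_of_length_eq_zero h h0)
    -- If `g` and `k` had no steps they would be identities and `h` would be `f`. Together with
    -- `hpos`, this makes both `h` and `g ≫ k` shorter than `f`.
    have hpos' : g.length + k.length ≠ 0 := by
      intro h0
      obtain @⟨x, y, p, f⟩ := f
      obtain rfl := TwoCell.eq_of_length_eq_zero g (by omega)
      obtain rfl := TwoCell.eq_id_of_length_eq_zero g (by omega)
      obtain rfl := TwoCell.eq_id_of_length_eq_zero k (by omega)
      apply hne
      simp only [Category.id_comp, Category.comp_id] at hf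
      rw [hf]
    have e₁ := congr_id_of_isElementary hΓ ⟨h⟩
    have e₂ := congr_id_of_isElementary hΓ ⟨g ≫ k⟩
    have e₃ := (e₁.comp_left (TwoCell.toInv g)).comp_right (TwoCell.toInv k)
    rw [Category.comp_id, ← TwoCell.toInv_comp, ← TwoCell.toInv_comp, ← TwoCell.toInv_comp,
      Category.assoc, ← hf] at e₃
    exact e₃.trans e₂
-- Cutting out a subloop lowers the number of steps; removing a context keeps that number but
-- shortens the base.
termination_by (f.cell.length, f.base.length)
decreasing_by
  all_goals simp only [Prod.lex_def]
  · right; exact ⟨hlen.symm, by omega⟩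
  · left; omega
  · left; change TwoCell.length (g ≫ k) < _; rw [TwoCell.length_comp]; omega

end Loop

/-- The chosen representative of a class need not be elementary itself; triviality passes from it to
the elementary loops of its class by rotation invariance. -/
theorem Labelling.congr_id_squierCompletion {W : Type*} [PartialOrder W] {ψ : S.Labelling W}
    (O : ψ.GeneratingConfluences) (L : S.LoopExtension) (f : S.Loop) :
    (squierCompletion O L).Congr (TwoCell.toInv f.cell) (𝟙 _) :=
  f.congr_id_of_isElementary fun f hf => (Loop.congr_id_iff_of_toClass_eq (L.toClass_rep _)).1
    (GlobularExtension.Congr.of (Γ := squierCompletion O L) (Sum.inr ⟨f.toClass, f, hf, rfl⟩))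

end TwoPolygraph

theorem mainTheorem1 (S : TwoPolygraph.{u, v, w}) (W : Type*) [PartialOrder W] [WellFoundedLT W]
    (ψ : S.Labelling W) (hψ : ψ.IsStrictlyDecreasing)
    (O : ψ.GeneratingConfluences) (L : S.LoopExtension)
    (hctx : ψ.IsCompatibleWithContexts)
    (hpeiffer : ψ.IsPeifferDecreasing (TwoPolygraph.Labelling.squierCompletion O L)) :
    (TwoPolygraph.Labelling.squierCompletion O L).IsCoherentPresentationOf
      S.PresentedCategory := by

  -- The presented category is the target category itself, so only the homotopy basis is at stake.
  refine ⟨⟨𝟭 _, 𝟭 _, rfl, rfl⟩, fun {x y p q} f g => ?_⟩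
  have hloc := TwoPolygraph.Labelling.isCoherentlyDecreasingAt_of_isCritical hctx hpeiffer
    fun _ => TwoPolygraph.Labelling.isCoherentlyDecreasingAt_squierCompletion_of_isCritical O L
  have hloop := TwoPolygraph.Labelling.congr_id_squierCompletion O L
  obtain ⟨t, h, k, hhk⟩ := TwoPolygraph.Labelling.exists_valley hloc (f ≫ Groupoid.inv g)
  exact (TwoPolygraph.GlobularExtension.congr_comp_inv_id_iff.1 (hhk.trans
    (TwoPolygraph.GlobularExtension.congr_comp_inv_id_iff.2
      (TwoPolygraph.Labelling.congr_of_parallel hloc hloop h k)))).nonempty_threeCell
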